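/- A topological group is a group with a topology for which multiplication and inversion are continuous and the identity is a closed point (so it is Hausdorff). Let $\mathbf{T}$ be the group of complex numbers of modulus $1$. A character of an abelian topological group $A$ is a continuous homomorphism $A \to \mathbf{T}$, and the dual group $\widehat{A}$ is the group of all characters of $A$ under pointwise multiplication, with the topology of uniform convergence on compact subsets of $A$; the second dual $\widehat{\widehat{A}}$ is the dual of $\widehat{A}$. For $a \in A$ let $\Psi_a \in \widehat{\widehat{A}}$ be the evaluation $\Psi_a(\varphi) = \varphi(a)$; the map $a \mapsto \Psi_a$ is a homomorphism $A \to \widehat{\widehat{A}}$. (1) If $A$ is a discrete abelian group, then $\widehat{A}$ is compact, the inclusion of $\widehat{A}$ in $\mathbf{T}^A$ with the product topology is a closed topological embedding, $\widehat{\widehat{A}}$ is discrete, and $a \mapsto \Psi_a$ is an isomorphism from $A$ onto $\widehat{\widehat{A}}$. (2) If $A$ is a compact abelian topological group, then $\widehat{A}$ is discrete, $\widehat{\widehat{A}}$ is compact, and $a \mapsto \Psi_a$ is an isomorphism of topological groups (a group isomorphism and a homeomorphism) from $A$ onto $\widehat{\widehat{A}}$. (3) If $A$ is any subgroup of a discrete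 abelian group $B$, then every character of $A$ extends to a character of $B$. (4) If $A$ is a closed subgroup of a compact abelian topological group $B$, with the induced topology, then every character of $A$ extends to a character of $B$. -/

import Mathlib

/-- For an abelian group `A` with a topology, the evaluation `Ψ_a : φ ↦ φ a` at `a : A`, as a
character of the dual group of `A`. Here `PontryaginDual A` is the group of continuous
homomorphisms from `A` to the unit circle, with pointwise multiplication and the topology of
uniform convergence on compact sets (the compact-open topology). -/
noncomputable def dualEvalAt {A : Type*} [CommGroup A] [TopologicalSpace A] (a : A) :
    PontryaginDual (PontryaginDual A) :=
  ({ toFun := fun φ : PontryaginDual A => φ a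
     map_one' := rfl
     map_mul' := fun _ _ => rfl
     continuous_toFun :=
      ContinuousEvalConst.continuous_eval_const (F := ContinuousMonoidHom A Circle) a } :
    ContinuousMonoidHom (PontryaginDual A) Circle)

theorem dualEvalAt_apply {A : Type*} [CommGroup A] [TopologicalSpace A] (a : A)
    (φ : PontryaginDual A) : dualEvalAt a φ = φ a := rfl

/-- The homomorphism `a ↦ Ψ_a` from `A` to its second dual. -/
noncomputable def dualEval (A : Type*) [CommGroup A] [TopologicalSpace A] :
    A →* PontryaginDual (PontryaginDual A) where
  toFun := dualEvalAt
  map_one' := PontryaginDual.ext fun φ => map_one φ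
  map_mul' := fun a b => PontryaginDual.ext fun φ => map_mul φ a b

/-!
Both duality statements rest on two separation principles for a compact abelian group `G`.

* A group `X` of characters of `G` that separates points contains every character
  (`PontryaginDual.subgroup_eq_top_of_separates`): by Stone–Weierstrass the span of `X` is dense in
  `C(G, ℂ)`, and a character outside `X` would be orthogonal to that span.
* The characters of `G` do separate points (`PontryaginDual.exists_apply_ne_one`). They are obtained
  from Gelfand theory: in the regular representation `U` on `L²(G)`, the double commutant of `U(G)`
  is a commutative C⋆-algebra containing the operators `U g` and `T f = ∫ f g • U g`. If `a ≠ 1`,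
  then `T f * (U a - 1) ≠ 0` for some `f`, so some character `φ` of this algebra does not vanish
  there. Then `g ↦ φ (U g)` is a homomorphism to the circle with `φ (U a) ≠ 1`, and it is continuous
  because `φ (U g) = φ (U g * T f) / φ (T f)` and `U g * T f` depends norm-continuously on `g`.

For discrete `A`, homomorphisms to the circle extend from subgroups, since the circle is divisible,
and separate points. Thus `A` embeds in its second dual, and its image, being a group of characters
of the compact dual that separates points, is the whole second dual. For compact `A`, the image of
`A` in the second dual is closed; a character of the second dual trivial on this image is, by
duality for the discrete dual of `A`, the evaluation at some `φ` that is trivial on `A`. So the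
quotient by the image has only the trivial character, and is therefore trivial. Finally, the
restrictions to a closed subgroup of the characters of a compact group separate points, so they
exhaust the characters of the subgroup.
-/

open MeasureTheory
open scoped InnerProductSpace

/-! ### Characters of discrete groups -/

/-- The circle is a divisible group, hence injective as a `ℤ`-module. -/
theorem Circle.baer_additive : Module.Baer ℤ (Additive Circle) := by
  have : DivisibleBy (Additive Circle) ℤ := divisibleByOfSMulRightSurj _ _ <| by
    intro n hn x
    obtain ⟨t, ht⟩ := Circle.exp_surjective x.toMul
    refine ⟨Additive.ofMul (Circle.exp (t / n)), ?_⟩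
    apply Additive.toMul.injective
    have hn' : (n : ℝ) ≠ 0 := by exact_mod_cast hn
    simp only [toMul_zsmul, toMul_ofMul]
    rw [← Circle.exp_intCast_mul, mul_div_cancel₀ _ hn', ht]
  exact Module.Baer.of_divisible _

theorem MonoidHom.exists_extension_circle {B : Type*} [CommGroup B] (A : Subgroup B)
    (φ : A →* Circle) : ∃ ψ : B →* Circle, ∀ a : A, ψ a = φ a := by
  obtain ⟨h, hh⟩ := Circle.baer_additive.extension_property_addMonoidHom
    (MonoidHom.toAdditive A.subtype) A.subtype_injective (MonoidHom.toAdditive φ)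
  exact ⟨MonoidHom.toAdditive.symm h, fun a =>
    congrArg Additive.toMul (DFunLike.congr_fun hh (Additive.ofMul a))⟩

/-- The embedding `q ↦ exp (2πiq)` of `ℚ / ℤ` in the circle. -/
noncomputable def ratAddCircleToCircle : AddCircle (1 : ℚ) →+ Additive Circle :=
  QuotientAddGroup.lift _
    { toFun := fun q : ℚ => Additive.ofMul (Circle.exp (2 * Real.pi * q))
      map_zero' := by simp
      map_add' := fun p q => by simp [mul_add, Circle.exp_add] }
    (by
      intro q hq
      obtain ⟨n, rfl⟩ := AddSubgroup.mem_zmultiples_iff.1 hq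
      simp [Circle.exp_two_pi_mul_int])

theorem ratAddCircleToCircle_injective : Function.Injective ratAddCircleToCircle := by
  rw [injective_iff_map_eq_zero]
  intro x hx
  induction x using QuotientAddGroup.induction_on with
  | H q =>
    have h : Circle.exp (2 * Real.pi * q) = 1 := hx
    obtain ⟨n, hn⟩ := Circle.exp_eq_one.1 h
    have hq : (q : ℝ) = n := by
      have := Real.pi_pos
      apply mul_left_cancel₀ (by positivity : (2 * Real.pi) ≠ 0)
      linarith
    rw [QuotientAddGroup.eq_zero_iff]
    have hq' : (n : ℚ) = q := by exact_mod_cast hq.symm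
    exact AddSubgroup.mem_zmultiples_iff.2 ⟨n, by simpa using hq'⟩

/-- Homomorphisms to `ℚ / ℤ` separate the elements of an abelian group, and `ℚ / ℤ` embeds in the
circle. -/
theorem MonoidHom.exists_circle_apply_ne_one {A : Type*} [CommGroup A] {a : A} (ha : a ≠ 1) :
    ∃ φ : A →* Circle, φ a ≠ 1 := by
  obtain ⟨c, hc⟩ := CharacterModule.exists_character_apply_ne_zero_of_ne_zero
    (A := Additive A) (a := Additive.ofMul a) ha
  refine ⟨MonoidHom.toAdditive.symm (ratAddCircleToCircle.comp c), fun h => hc ?_⟩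
  exact (map_eq_zero_iff _ ratAddCircleToCircle_injective).1 h

/-! ### Subgroups of the dual of a compact group that separate points -/

section Orthogonality

variable {G : Type*} [CommGroup G] [TopologicalSpace G]

/-- A character, regarded as a continuous complex-valued function. -/
noncomputable def PontryaginDual.toContinuousMapHom : PontryaginDual G →* C(G, ℂ) where
  toFun χ := ⟨fun x => ((χ x : Circle) : ℂ), continuous_induced_dom.comp (map_continuous χ)⟩
  map_one' := by ext; simp
  map_mul' χ ψ := by ext x; exact Circle.coe_mul (χ x) (ψ x)

theorem PontryaginDual.toContinuousMapHom_apply (χ : PontryaginDual G) (x : G) :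
    toContinuousMapHom χ x = ((χ x : Circle) : ℂ) := rfl

theorem PontryaginDual.star_toContinuousMapHom (χ : PontryaginDual G) :
    star (toContinuousMapHom χ) = toContinuousMapHom χ⁻¹ := by
  ext x
  exact (Circle.coe_inv_eq_conj (χ x)).symm

variable [IsTopologicalGroup G] [MeasurableSpace G] [BorelSpace G]

/-- Translating the variable by `a` multiplies the integral of `χ` by `χ a`. -/
theorem PontryaginDual.integral_eq_zero (μ : Measure G) [μ.IsMulLeftInvariant]
    {χ : PontryaginDual G} (hχ : χ ≠ 1) : ∫ x, toContinuousMapHom χ x ∂μ = 0 := by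
  obtain ⟨a, ha⟩ : ∃ a, χ a ≠ 1 := by
    by_contra! h
    exact hχ (PontryaginDual.ext h)
  have h := integral_mul_left_eq_self (μ := μ) (toContinuousMapHom χ) a
  simp only [toContinuousMapHom_apply, _root_.map_mul, Circle.coe_mul, integral_const_mul] at h ⊢
  by_contra h0
  exact ha (Circle.ext (by simpa using mul_right_cancel₀ h0 (h.trans (one_mul _).symm)))

end Orthogonality

/-- Stone–Weierstrass makes the linear span of `X` dense in the continuous functions, while a
character outside `X` is orthogonal to that span for the Haar integral. -/
theorem PontryaginDual.subgroup_eq_top_of_separates {G : Type*} [CommGroup G] [TopologicalSpace G]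
    [IsTopologicalGroup G] [CompactSpace G] [T2Space G] (X : Subgroup (PontryaginDual G))
    (hX : ∀ x : G, x ≠ 1 → ∃ χ ∈ X, χ x ≠ 1) : X = ⊤ := by
  borelize G
  set μ : Measure G := Measure.haar
  rw [eq_top_iff]
  rintro ψ -
  by_contra hψ
  set s : Set C(G, ℂ) := toContinuousMapHom '' X
  have hstar : star s = s := by
    have key : ∀ f ∈ s, star f ∈ s := by
      rintro _ ⟨χ, hχ, rfl⟩
      exact ⟨χ⁻¹, X.inv_mem hχ, (star_toContinuousMapHom χ).symm⟩
    refine Set.Subset.antisymm (fun f hf => ?_) fun f hf => key f hf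
    simpa using key _ hf
  set S : StarSubalgebra ℂ C(G, ℂ) := StarAlgebra.adjoin ℂ s
  have hsep : S.SeparatesPoints := by
    intro x y hxy
    obtain ⟨χ, hχ, hne⟩ := hX (x / y) (div_ne_one.2 hxy)
    refine ⟨_, ⟨toContinuousMapHom χ, StarAlgebra.subset_adjoin ℂ s ⟨χ, hχ, rfl⟩, rfl⟩, ?_⟩
    intro h
    rw [_root_.map_div] at hne
    exact hne (div_eq_one.2 (Circle.ext h))
  have htop := ContinuousMap.starSubalgebra_topologicalClosure_eq_top_of_separatesPoints S hsep
  have hspan : ∀ f ∈ S, f ∈ Submodule.span ℂ s := by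
    intro f hf
    have h1 : f ∈ Algebra.adjoin ℂ (s ∪ star s) := hf
    rw [hstar, Set.union_self, ← Subalgebra.mem_toSubmodule, Algebra.adjoin_eq_span] at h1
    have h2 : Submonoid.closure s = X.toSubmonoid.map toContinuousMapHom :=
      Submonoid.closure_eq (X.toSubmonoid.map toContinuousMapHom)
    rwa [h2] at h1
  have hint : ∀ f : C(G, ℂ), Integrable f μ := fun f =>
    f.continuous.integrable_of_hasCompactSupport (HasCompactSupport.of_compactSpace _)
  -- the Fourier coefficient at `ψ`
  let Λ : C(G, ℂ) →ₗ[ℂ] ℂ :=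
    { toFun := fun f => ∫ x, (f * toContinuousMapHom ψ⁻¹) x ∂μ
      map_add' := fun f g => by
        simp only [add_mul, ContinuousMap.add_apply]
        exact integral_add (hint _) (hint _)
      map_smul' := fun c f => by
        simp only [smul_mul_assoc, ContinuousMap.smul_apply, integral_smul, RingHom.id_apply] }
  have hΛ : Continuous Λ := by
    refine AddMonoidHomClass.continuous_of_bound Λ (μ.real Set.univ) fun f => ?_
    rw [mul_comm]
    refine norm_integral_le_of_norm_le_const (.of_forall fun x => ?_)
    simpa [toContinuousMapHom_apply, Circle.norm_coe] using f.norm_coe_le_norm x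
  have hzero : ∀ f ∈ Submodule.span ℂ s, Λ f = 0 := by
    intro f hf
    refine (Submodule.span_le (p := LinearMap.ker Λ)).2 ?_ hf
    rintro _ ⟨χ, hχ, rfl⟩
    change ∫ x, (toContinuousMapHom χ * toContinuousMapHom ψ⁻¹) x ∂μ = 0
    rw [← _root_.map_mul]
    refine integral_eq_zero μ fun h => hψ ?_
    rwa [← mul_inv_eq_one.1 h]
  have hψ0 : Λ (toContinuousMapHom ψ) = 0 := by
    have hmem : toContinuousMapHom ψ ∈ closure (S : Set C(G, ℂ)) := by
      rw [← StarSubalgebra.topologicalClosure_coe, htop]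
      trivial
    exact closure_minimal (fun f hf => hzero f (hspan f hf)) (isClosed_singleton.preimage hΛ) hmem
  have hψ1 : Λ (toContinuousMapHom ψ) = μ.real Set.univ := by
    change ∫ x, (toContinuousMapHom ψ * toContinuousMapHom ψ⁻¹) x ∂μ = _
    rw [← _root_.map_mul, mul_inv_cancel, _root_.map_one]
    simp
  rw [hψ0] at hψ1
  have : μ.real Set.univ ≠ 0 := by
    simp [Measure.real, ENNReal.toReal_eq_zero_iff, NeZero.ne μ]
  exact this (by exact_mod_cast hψ1.symm)

/-! ### Characters occurring in a unitary representation of a compact group -/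

/-- A nonzero element of a closed commutative star subalgebra of a C⋆-algebra is not annihilated
by all characters of the subalgebra. -/
theorem StarSubalgebra.exists_starAlgHom_apply_ne_zero {A : Type*} [CStarAlgebra A]
    (S : StarSubalgebra ℂ A) (hS : IsClosed (S : Set A)) (hcomm : ∀ x y : S, x * y = y * x)
    {x : S} (hx : x ≠ 0) : ∃ φ : S →⋆ₐ[ℂ] ℂ, Continuous φ ∧ φ x ≠ 0 := by
  have : IsClosed (S : Set A) := hS
  let _ : CommCStarAlgebra S := { StarSubalgebra.cstarAlgebra S with mul_comm := hcomm }
  have hne : WeakDual.gelfandTransform ℂ S x ≠ 0 := fun h =>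
    hx ((gelfandTransform_isometry S).injective (h.trans (map_zero _).symm))
  obtain ⟨φ, hφ⟩ := DFunLike.ne_iff.1 hne
  exact ⟨φ, map_continuous φ, hφ⟩

section Representation

variable {G : Type*} [CommGroup G] [TopologicalSpace G] [CompactSpace G]
  {H : Type*} [NormedAddCommGroup H] [InnerProductSpace ℂ H] [CompleteSpace H]
  [MeasurableSpace G] [BorelSpace G]

theorem integrable_smul_unitary (μ : Measure G) [IsFiniteMeasure μ]
    (U : G →* unitary (H →L[ℂ] H)) (hU : ∀ v, Continuous fun g => (U g : H →L[ℂ] H) v)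
    (f : C(G, ℂ)) (v : H) : Integrable (fun g => f g • (U g : H →L[ℂ] H) v) μ :=
  (f.continuous.smul (hU v)).integrable_of_hasCompactSupport (HasCompactSupport.of_compactSpace _)

theorem norm_unitary_apply (U : unitary (H →L[ℂ] H)) (v : H) : ‖(U : H →L[ℂ] H) v‖ = ‖v‖ :=
  (Unitary.linearIsometryEquiv U).norm_map v

/-- For a unitary representation `U` of `G`, the operator `v ↦ ∫ g, f g • U g v`, as a function
of `f`. -/
noncomputable def integratedRep (μ : Measure G) [IsFiniteMeasure μ]
    (U : G →* unitary (H →L[ℂ] H)) (hU : ∀ v, Continuous fun g => (U g : H →L[ℂ] H) v) :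
    C(G, ℂ) →L[ℂ] H →L[ℂ] H :=
  LinearMap.mkContinuous₂
    (LinearMap.mk₂ ℂ (fun f v => ∫ g, f g • (U g : H →L[ℂ] H) v ∂μ)
      (fun f f' v => by
        simp only [ContinuousMap.add_apply, add_smul]
        exact integral_add (integrable_smul_unitary μ U hU f v)
          (integrable_smul_unitary μ U hU f' v))
      (fun c f v => by
        simp only [ContinuousMap.smul_apply, smul_assoc, integral_smul])
      (fun f v v' => by
        simp only [map_add, smul_add]
        exact integral_add (integrable_smul_unitary μ U hU f v)
          (integrable_smul_unitary μ U hU f v'))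
      (fun c f v => by
        simp only [map_smul, smul_comm _ c, integral_smul]))
    (μ.real Set.univ) fun f v => by
      rw [mul_assoc, mul_comm]
      refine norm_integral_le_of_norm_le_const (.of_forall fun g => ?_)
      rw [norm_smul, norm_unitary_apply]
      gcongr
      exact f.norm_coe_le_norm g

theorem integratedRep_apply (μ : Measure G) [IsFiniteMeasure μ]
    (U : G →* unitary (H →L[ℂ] H)) (hU : ∀ v, Continuous fun g => (U g : H →L[ℂ] H) v)
    (f : C(G, ℂ)) (v : H) :
    integratedRep μ U hU f v = ∫ g, f g • (U g : H →L[ℂ] H) v ∂μ := rfl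

/-- The integrated operators lie in the double commutant of the representation. -/
theorem commute_integratedRep (μ : Measure G) [IsFiniteMeasure μ]
    (U : G →* unitary (H →L[ℂ] H)) (hU : ∀ v, Continuous fun g => (U g : H →L[ℂ] H) v)
    (f : C(G, ℂ)) {R : H →L[ℂ] H} (hR : ∀ g, Commute R (U g)) :
    Commute R (integratedRep μ U hU f) := by
  ext v
  have h : ∀ g, R ((U g : H →L[ℂ] H) v) = (U g : H →L[ℂ] H) (R v) := fun g =>
    DFunLike.congr_fun (hR g) v
  simp only [mul_apply_eq_comp, integratedRep_apply]
  rw [← R.integral_comp_comm (integrable_smul_unitary μ U hU f v)]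
  simp only [map_smul, h]

/-- Invariance of the measure turns composition with `U a` into a translation of `f`. -/
theorem mul_integratedRep [IsTopologicalGroup G] (μ : Measure G) [IsFiniteMeasure μ]
    [μ.IsMulLeftInvariant]
    (U : G →* unitary (H →L[ℂ] H)) (hU : ∀ v, Continuous fun g => (U g : H →L[ℂ] H) v)
    (f : C(G, ℂ)) (a : G) :
    (U a : H →L[ℂ] H) * integratedRep μ U hU f =
      integratedRep μ U hU (f.comp ⟨fun g => a⁻¹ * g, continuous_const_mul _⟩) := by
  ext v
  simp only [mul_apply_eq_comp, integratedRep_apply]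
  rw [← (U a : H →L[ℂ] H).integral_comp_comm (integrable_smul_unitary μ U hU f v),
    ← integral_mul_left_eq_self (μ := μ)
      (fun g => f.comp ⟨fun g => a⁻¹ * g, continuous_const_mul _⟩ g • (U g : H →L[ℂ] H) v) a]
  simp

/-- The witness `f` is the complex conjugate of the matrix coefficient `g ↦ ⟪w, U g w⟫`. -/
theorem exists_integratedRep_apply_ne_zero (μ : Measure G) [IsFiniteMeasure μ]
    [μ.IsOpenPosMeasure]
    (U : G →* unitary (H →L[ℂ] H)) (hU : ∀ v, Continuous fun g => (U g : H →L[ℂ] H) v)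
    {w : H} (hw : w ≠ 0) : ∃ f, integratedRep μ U hU f w ≠ 0 := by
  let c : C(G, ℂ) := ⟨fun g => ⟪w, (U g : H →L[ℂ] H) w⟫_ℂ, continuous_const.inner (hU w)⟩
  refine ⟨star c, fun h => ?_⟩
  have h1 : ⟪w, integratedRep μ U hU (star c) w⟫_ℂ = ∫ g, ((‖c g‖ ^ 2 : ℝ) : ℂ) ∂μ := by
    rw [integratedRep_apply, ← integral_inner (integrable_smul_unitary μ U hU _ w)]
    refine integral_congr_ae (.of_forall fun g => ?_)
    simp only [inner_smul_right]
    rw [Complex.ofReal_pow, ← Complex.conj_mul']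
    rfl
  have h2 : 0 < ∫ g, ‖c g‖ ^ 2 ∂μ := by
    refine Continuous.integral_pos_of_hasCompactSupport_nonneg_nonzero (x := 1)
      (by fun_prop) (HasCompactSupport.of_compactSpace _) (fun g => by positivity) ?_
    simpa [c] using hw
  rw [h, inner_zero_right, integral_complex_ofReal] at h1
  exact h2.ne' (Complex.ofReal_eq_zero.1 h1.symm)

end Representation

/-- Gelfand theory for the double commutant of the representation: a character `φ` of this
commutative C⋆-algebra gives the homomorphism `g ↦ φ (U g)`. It is continuous as soon as `φ` does
not vanish on some operator `T = ∫ f g • U g`, because `U g * T` depends norm-continuously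
on `g`. -/
theorem exists_character_apply_ne_one_of_unitary {G : Type*} [CommGroup G] [TopologicalSpace G]
    [IsTopologicalGroup G] [CompactSpace G] {H : Type*} [NormedAddCommGroup H]
    [InnerProductSpace ℂ H] [CompleteSpace H]
    (U : G →* unitary (H →L[ℂ] H)) (hU : ∀ v, Continuous fun g => (U g : H →L[ℂ] H) v)
    {a : G} (ha : U a ≠ 1) : ∃ χ : PontryaginDual G, χ a ≠ 1 := by
  borelize G
  set μ : Measure G := Measure.haar
  obtain ⟨v, hv⟩ : ∃ v, (U a : H →L[ℂ] H) v ≠ v := by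
    by_contra! h
    exact ha (Subtype.ext (ContinuousLinearMap.ext h))
  obtain ⟨f, hf⟩ := exists_integratedRep_apply_ne_zero μ U hU (sub_ne_zero.2 hv)
  set T := integratedRep μ U hU
  let s : Set (H →L[ℂ] H) := Set.range fun g => (U g : H →L[ℂ] H)
  -- the double commutant is closed, commutative, and contains both the `U g` and the `T f`
  let S : StarSubalgebra ℂ (H →L[ℂ] H) :=
    StarSubalgebra.centralizer ℂ (StarSubalgebra.centralizer ℂ s : Set (H →L[ℂ] H))
  have hclosed : IsClosed (S : Set (H →L[ℂ] H)) := Set.isClosed_centralizer _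
  have hUS : ∀ g, (U g : H →L[ℂ] H) ∈ S := fun g =>
    StarAlgebra.adjoin_le_centralizer_centralizer ℂ s
      (StarAlgebra.subset_adjoin ℂ s ⟨g, rfl⟩)
  have hTS : ∀ f, T f ∈ S := by
    intro f
    rw [StarSubalgebra.mem_centralizer_iff]
    -- an operator commuting with every `U g` commutes with the integrals `T f`
    have key : ∀ R ∈ StarSubalgebra.centralizer ℂ s, R * T f = T f * R := fun R hR =>
      commute_integratedRep μ U hU f fun g =>
        ((StarSubalgebra.mem_centralizer_iff ℂ).1 hR _ ⟨g, rfl⟩).1.symm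
    exact fun R hR => ⟨key R hR, key _ (star_mem hR)⟩
  have hcomm : ∀ x y : S, x * y = y * x := by
    have hs : star s = s := by
      have key : ∀ R ∈ s, star R ∈ s := by
        rintro _ ⟨g, rfl⟩
        exact ⟨g⁻¹, congrArg Subtype.val (map_inv U g)⟩
      refine Set.Subset.antisymm (fun R hR => ?_) fun R hR => key R hR
      simpa using key _ hR
    rintro ⟨x, hx⟩ ⟨y, hy⟩
    rw [← SetLike.mem_coe, StarSubalgebra.coe_centralizer_centralizer, hs, Set.union_self] at hx hy
    refine Subtype.ext (Set.centralizer_centralizer_comm_of_comm ?_ _ hx _ hy)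
    rintro _ ⟨g, rfl⟩ _ ⟨h, rfl⟩
    change ((U g * U h : unitary (H →L[ℂ] H)) : H →L[ℂ] H) = (U h * U g : unitary (H →L[ℂ] H))
    rw [← map_mul, mul_comm, map_mul]
  let u : G → S := fun g => ⟨U g, hUS g⟩
  let t : C(G, ℂ) → S := fun f => ⟨T f, hTS f⟩
  have ht : Continuous t := T.continuous.subtype_mk _
  -- nonvanishing of `φ` on this product gives both `φ (u a) ≠ 1` and `φ (t f) ≠ 0`
  have hx : t f * (u a - 1) ≠ 0 := by
    intro h
    apply hf
    simpa using DFunLike.congr_fun (congrArg Subtype.val h) v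
  obtain ⟨φ, hφ, hne⟩ := S.exists_starAlgHom_apply_ne_zero hclosed hcomm hx
  rw [map_mul, map_sub, map_one, mul_ne_zero_iff, sub_ne_zero] at hne
  have hu : ∀ g, ‖φ (u g)‖ = 1 := by
    intro g
    have h : star (u g) * u g = 1 := Subtype.ext (Unitary.coe_star_mul_self (U g))
    have h' := congrArg φ h
    rw [map_mul, map_star, map_one] at h'
    have : ‖φ (u g)‖ ^ 2 = 1 := by
      have h2 := Complex.conj_mul' (φ (u g))
      exact_mod_cast h2.symm.trans h'
    exact (pow_eq_one_iff_of_nonneg (norm_nonneg _) two_ne_zero).1 this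
  have hcont : Continuous fun g => φ (u g) := by
    have h : ∀ g, φ (u g) =
        φ (t (f.comp ⟨fun x => g⁻¹ * x, continuous_const_mul _⟩)) / φ (t f) := by
      intro g
      rw [eq_div_iff hne.1, ← map_mul]
      exact congrArg φ (Subtype.ext (mul_integratedRep μ U hU f g))
    simp_rw [h]
    refine (hφ.comp (ht.comp ?_)).div_const _
    refine ContinuousMap.continuous_of_continuous_uncurry _ ?_
    exact f.continuous.comp (by fun_prop : Continuous fun p : G × G => p.1⁻¹ * p.2)
  let χ : G →ₜ* Circle :=
    { toFun := fun g => ⟨φ (u g), mem_sphere_zero_iff_norm.2 (hu g)⟩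
      map_one' := Circle.ext (by
        have : u 1 = 1 := Subtype.ext (by simp [u])
        simp [this])
      map_mul' := fun g h => Circle.ext (by
        have : u (g * h) = u g * u h := Subtype.ext (by simp [u])
        exact (congrArg φ this).trans (map_mul φ _ _))
      continuous_toFun := hcont.subtype_mk _ }
  exact ⟨χ, fun h => hne.2 (congrArg Subtype.val h)⟩

/-! ### The regular representation -/

section Regular

variable {G : Type*} [CommGroup G] [TopologicalSpace G] [IsTopologicalGroup G]
  [MeasurableSpace G] [BorelSpace G]

/-- The regular representation of a compact abelian group: `g` acts on square-integrable functions
by translating the variable by `g`. Commutativity makes this right action a left action. -/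
noncomputable def regularRep (μ : Measure G) [μ.IsMulLeftInvariant] :
    G →* (Lp ℂ 2 μ ≃ₗᵢ[ℂ] Lp ℂ 2 μ) where
  toFun g :=
    { toFun := fun f => DomMulAct.mk g • f
      map_add' := smul_add _
      map_smul' := fun c f => smul_comm _ c f
      invFun := fun f => DomMulAct.mk g⁻¹ • f
      left_inv := fun f => by simp [← mul_smul]
      right_inv := fun f => by simp [← mul_smul]
      norm_map' := fun f => DomMulAct.norm_smul_Lp _ f }
  map_one' := by ext1 f; exact one_smul Gᵈᵐᵃ f
  map_mul' g h := by
    ext1 f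
    change DomMulAct.mk (g * h) • f = DomMulAct.mk g • DomMulAct.mk h • f
    rw [mul_comm, DomMulAct.mk_mul, mul_smul]

theorem continuous_regularRep_apply [CompactSpace G] (μ : Measure G) [μ.IsMulLeftInvariant]
    [μ.Regular] (f : Lp ℂ 2 μ) : Continuous fun g => regularRep μ g f := by
  have : Fact ((2 : ENNReal) ≠ ⊤) := ⟨ENNReal.ofNat_ne_top⟩
  have h : Continuous fun c : Gᵈᵐᵃ => c • f := continuous_id.smul continuous_const
  exact h.comp DomMulAct.continuous_mk

/-- A continuous function taking different values at `1` and `a` is moved by `a`, also as an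
element of `Lp ℂ 2 μ`, since Haar measure is positive on nonempty open sets. -/
theorem regularRep_ne_one [CompactSpace G] [T2Space G] (μ : Measure G) [μ.IsHaarMeasure]
    {a : G} (ha : a ≠ 1) : regularRep μ a ≠ 1 := by
  intro h
  obtain ⟨f, hf0, hf1, -⟩ := exists_continuous_zero_one_of_isClosed
    (isClosed_singleton (x := (1 : G))) (isClosed_singleton (x := a)) (by simpa using ha.symm)
  let F : C(G, ℂ) := ⟨fun x => (f x : ℂ), by fun_prop⟩
  have h1 : DomMulAct.mk a • ContinuousMap.toLp 2 μ ℂ F = ContinuousMap.toLp 2 μ ℂ F :=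
    DFunLike.congr_fun h _
  have h2 : ContinuousMap.toLp 2 μ ℂ (F.comp ⟨fun x => a * x, continuous_const_mul _⟩) =
      ContinuousMap.toLp 2 μ ℂ F := h1
  have h3 := DFunLike.congr_fun (ContinuousMap.toLp_injective μ h2) 1
  have h4 : f (a * 1) = f 1 := Complex.ofReal_injective h3
  rw [mul_one, hf0 rfl, hf1 rfl] at h4
  exact one_ne_zero h4

end Regular

/-- The characters of a compact abelian group separate its points, because the regular
representation is faithful. -/
theorem PontryaginDual.exists_apply_ne_one {G : Type*} [CommGroup G] [TopologicalSpace G]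
    [IsTopologicalGroup G] [CompactSpace G] [T2Space G] {a : G} (ha : a ≠ 1) :
    ∃ χ : PontryaginDual G, χ a ≠ 1 := by
  borelize G
  let e := Unitary.linearIsometryEquiv (𝕜 := ℂ) (H := Lp ℂ 2 (Measure.haar : Measure G))
  refine exists_character_apply_ne_one_of_unitary
    (e.symm.toMonoidHom.comp (regularRep (Measure.haar : Measure G)))
    (continuous_regularRep_apply _) fun h => ?_
  exact regularRep_ne_one Measure.haar ha (e.symm.map_eq_one_iff.1 h)

/-! ### Duality and extension of characters -/

/-- For surjectivity, the evaluations form a group of characters of the compact group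
`PontryaginDual A` that separates points, so they are all of its characters. -/
theorem dualEval_bijective_of_discrete (A : Type*) [CommGroup A] [TopologicalSpace A]
    [DiscreteTopology A] : Function.Bijective (dualEval A) := by
  constructor
  · rw [injective_iff_map_eq_one]
    intro a h
    by_contra ha
    obtain ⟨φ, hφ⟩ := MonoidHom.exists_circle_apply_ne_one ha
    let φ' : A →ₜ* Circle := ⟨φ, continuous_of_discreteTopology⟩
    exact hφ (DFunLike.congr_fun h (φ' : PontryaginDual A))
  · rw [← MonoidHom.range_eq_top]
    refine PontryaginDual.subgroup_eq_top_of_separates _ fun φ hφ => ?_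
    by_contra! h
    exact hφ (PontryaginDual.ext fun a => h _ ⟨a, rfl⟩)

theorem continuous_dualEval (A : Type*) [CommGroup A] [TopologicalSpace A] [CompactSpace A] :
    Continuous (dualEval A) := by
  have h : Topology.IsClosedEmbedding
      fun (Φ : PontryaginDual (PontryaginDual A)) (φ : PontryaginDual A) => Φ φ :=
    ContinuousMonoidHom.isClosedEmbedding_coe
  exact h.continuous_iff.2 (continuous_pi fun φ => map_continuous φ)

/-- For surjectivity, a character of the second dual that is trivial on the (closed) image of `A`
is the evaluation at some `φ` in the dual of `A`, by duality for the discrete dual of `A`; it is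
thus trivial. Since characters separate the points of the quotient by the image, the image is
everything. -/
theorem dualEval_bijective_of_compact (A : Type*) [CommGroup A] [TopologicalSpace A]
    [IsTopologicalGroup A] [T2Space A] [CompactSpace A] : Function.Bijective (dualEval A) := by
  constructor
  · rw [injective_iff_map_eq_one]
    intro a h
    by_contra ha
    obtain ⟨φ, hφ⟩ := PontryaginDual.exists_apply_ne_one ha
    exact hφ (DFunLike.congr_fun h φ)
  · set R := (dualEval A).range with hR
    have hclosed : IsClosed (R : Set (PontryaginDual (PontryaginDual A))) := by
      rw [hR, MonoidHom.coe_range]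
      exact (isCompact_range (continuous_dualEval A)).isClosed
    intro Φ
    by_contra hΦ
    have hΦ' : (Φ : PontryaginDual (PontryaginDual A) ⧸ R) ≠ 1 := fun h =>
      hΦ ((QuotientGroup.eq_one_iff Φ).1 h)
    obtain ⟨χ, hχ⟩ := PontryaginDual.exists_apply_ne_one hΦ'
    let π : PontryaginDual (PontryaginDual A) →ₜ* PontryaginDual (PontryaginDual A) ⧸ R :=
      ⟨QuotientGroup.mk' R, continuous_quot_mk⟩
    obtain ⟨φ, hφ⟩ := (dualEval_bijective_of_discrete (PontryaginDual A)).2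
      (PontryaginDual.map π χ)
    have hφ1 : φ = 1 := by
      refine PontryaginDual.ext fun a => ?_
      have h1 : dualEval A a φ = χ (dualEval A a : PontryaginDual (PontryaginDual A)) :=
        DFunLike.congr_fun hφ (dualEval A a)
      rw [(QuotientGroup.eq_one_iff _).2 (⟨a, rfl⟩ : dualEval A a ∈ R), map_one] at h1
      exact h1
    have h2 : Φ φ = χ (Φ : PontryaginDual (PontryaginDual A) ⧸ R) := DFunLike.congr_fun hφ Φ
    rw [hφ1, map_one] at h2
    exact hχ h2.symm

theorem PontryaginDual.exists_extension_of_discrete {B : Type*} [CommGroup B] [TopologicalSpace B]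
    [DiscreteTopology B] (A : Subgroup B) (φ : PontryaginDual A) :
    ∃ ψ : PontryaginDual B, ∀ a : A, ψ (a : B) = φ a := by
  obtain ⟨ψ, hψ⟩ := MonoidHom.exists_extension_circle A (φ : A →* Circle)
  let ψ' : B →ₜ* Circle := ⟨ψ, continuous_of_discreteTopology⟩
  exact ⟨ψ', hψ⟩

/-- The restrictions of the characters of `B` form a group of characters of `A` that separates
points, so they are all the characters of `A`. -/
theorem PontryaginDual.exists_extension_of_compact {B : Type*} [CommGroup B] [TopologicalSpace B]
    [IsTopologicalGroup B] [T2Space B] [CompactSpace B] (A : Subgroup B)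
    (hA : IsClosed (A : Set B)) (φ : PontryaginDual A) :
    ∃ ψ : PontryaginDual B, ∀ a : A, ψ (a : B) = φ a := by
  have : CompactSpace A := isCompact_iff_compactSpace.1 hA.isCompact
  let ι : A →ₜ* B := ⟨A.subtype, continuous_subtype_val⟩
  have htop : (PontryaginDual.map ι).toMonoidHom.range = ⊤ := by
    refine subgroup_eq_top_of_separates _ fun a ha => ?_
    obtain ⟨χ, hχ⟩ := exists_apply_ne_one (a := (a : B)) (by simpa using ha)
    exact ⟨_, ⟨χ, rfl⟩, hχ⟩
  obtain ⟨ψ, hψ⟩ := MonoidHom.range_eq_top.1 htop φ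
  exact ⟨ψ, fun a => DFunLike.congr_fun hψ a⟩

theorem mainTheorem4 :
    -- discrete groups
    (∀ (A : Type*) [CommGroup A] [TopologicalSpace A] [DiscreteTopology A],
      CompactSpace (PontryaginDual A) ∧
      Topology.IsClosedEmbedding (fun (φ : PontryaginDual A) (a : A) => φ a) ∧
      DiscreteTopology (PontryaginDual (PontryaginDual A)) ∧
      Function.Bijective (dualEval A)) ∧
    -- compact groups
    (∀ (A : Type*) [CommGroup A] [TopologicalSpace A] [IsTopologicalGroup A] [T2Space A]
        [CompactSpace A],
      DiscreteTopology (PontryaginDual A) ∧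
      CompactSpace (PontryaginDual (PontryaginDual A)) ∧
      IsHomeomorph (dualEval A)) ∧
    -- extension of characters from a subgroup of a discrete group
    (∀ (B : Type*) [CommGroup B] [TopologicalSpace B] [DiscreteTopology B] (A : Subgroup B)
        (φ : PontryaginDual A),
      ∃ ψ : PontryaginDual B, ∀ a : A, ψ (a : B) = φ a) ∧
    -- extension of characters from a closed subgroup of a compact group
    (∀ (B : Type*) [CommGroup B] [TopologicalSpace B] [IsTopologicalGroup B] [T2Space B]
        [CompactSpace B] (A : Subgroup B), IsClosed (A : Set B) →
      ∀ φ : PontryaginDual A, ∃ ψ : PontryaginDual B, ∀ a : A, ψ (a : B) = φ a) := by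
  refine ⟨fun A _ _ _ => ⟨inferInstance, ContinuousMonoidHom.isClosedEmbedding_coe, inferInstance,
    dualEval_bijective_of_discrete A⟩, fun A _ _ _ _ _ => ⟨inferInstance, inferInstance,
    isHomeomorph_iff_continuous_bijective.2
      ⟨continuous_dualEval A, dualEval_bijective_of_compact A⟩⟩, ?_, ?_⟩
  · intro B _ _ _ A φ
    exact PontryaginDual.exists_extension_of_discrete A φ
  · intro B _ _ _ _ _ A hA φ
    exact PontryaginDual.exists_extension_of_compact A hA φ
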